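/- **Setting.** Consider the $n$-dimensional torus of size $k_1\times\cdots\times k_n$ ($k_i\ge 1$). Every unidirectional link has three first-in first-out packet queues of finite capacity: one for an adaptive virtual channel, and two for the virtual escape subnetworks $VS_1$ and $VS_2$ into which the escape (bubble) channel of the Adaptive Bubble Router is split. The adaptive capacity is arbitrary; the queues of $VS_1$ and of $VS_2$ have capacity at least $2$. Every node has a generator, which may at any time append a packet with an arbitrary final destination to its FIFO list of waiting packets, and a sink, which always accepts packets. Initially there are no packets. **Routing.** When the first packet waiting at the generator of $s$, with final destination $t$, is injected, it is given an intermediate destination or none. The packet is routed to its intermediate destination (if any), which is removed from its header when it is reached, and then to $t$. At each step one packet, which is the first at a generator or in a queue, is handled by its current router $v$: * if it has no pending intermediate destination and $v$ is its final destination, it is consumed by the sink of $v$; * otherwise it may enter any non-full adaptive queue of an outgoing link of $v$ that lies on a minimal path to its current target (the pending intermediate destination, or else the final one); * if all those adaptive queues are full, it may enter the escape queue of an outgoing link of $v$ that is the next link of a minimal dimension-order route to its current target. The queue is the one of $VS_1$ if the packet heads to an intermediate destination, and the one of $VS_2$ if it heads to its final destination. One free slot is needed if the packet comes from a queue of the same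 escape subnetwork along the same dimension and direction. Every other entry (from a generator, from an adaptive queue, from another dimension, or from $VS_1$ into $VS_2$) is an injection and needs at least two free slots. **OutFlank Routing (OFR).** For all $s,t$ a finite set $\mathcal Q(s,t)$ of candidate intermediate destinations is given. Each candidate is either a wraparound one, with coordinates $q_i=\lfloor (s_i+t_i+\beta_i k_i)/2\rfloor \bmod k_i$, $\beta_i\in\{0,1\}$, or an outflank one with parameter $\Delta\in\mathbb N$. The latter is given by $\lambda\in\{-1,0,1\}^n$. If $s_i=t_i$, then $q_i=(s_i+\lambda_i\Delta)\bmod k_i$. If $s_i\ne t_i$ and $\lambda_i=0$, then $q_i=\lfloor (s_i+t_i)/2\rfloor$. If $s_i\neq t_i$ and $\lambda_i=\pm1$, then $q_i=(t_i\pm\Delta)\bmod k_i$ if the link leaving $s$ along dimension $i$ in direction $\pm$ is minimal towards $t$, and $q_i=(s_i\pm\Delta)\bmod k_i$ otherwise. Moreover, minimal paths from $s$ to $q$ must be able to use an outgoing link of $s$ that is not on a minimal path from $s$ to $t$, and minimal paths from $q$ to $t$ an incoming link of $t$ that is not on a minimal path from $s$ to $t$. With $d$ the distance in the torus, $u_q(s)$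 the average number of used slots in the outgoing links of $s$ that are minimal towards $q$, and $u_*(s)$ the minimum number of used slots in an outgoing link of $s$, the profits are $$\pi_q(s,t)=\frac{u_*(s)}{u_q(s)}+\eta\,\frac{d(s,t)}{d(s,q)+d(q,t)},\qquad \pi_0(s,t)=\frac{u_*(s)}{u_t(s)}+\eta ,$$ where $\eta\in\mathbb R$ and the first fraction is $1$ if both its terms vanish (and any other quotient with denominator $0$ is read as $0$). If $\pi_q(s,t)\le\pi_0(s,t)$ for all $q\in\mathcal Q(s,t)$, the packet gets no intermediate destination; otherwise it gets some $q\in\mathcal Q(s,t)$ of maximal profit. **Theorem.** OFR, implemented in this way, is free from deadlock. That is, in every reachable configuration: 1. no packet, in the network or waiting at a generator, is permanently stuck (for each packet there is a continuation in which it leaves its place); 2. if there is an undelivered packet, then some packet can move; 3. without any new traffic, there is a sequence of moves after which all the packets present have been consumed at their final destinations. Moreover, no queue ever exceeds its capacity, $VS_1$ only holds packets heading to an intermediate destination, and $VS_2$ only holds packets heading to their final destination. The same conclusions hold if the intermediate destination of a newly injected packet is chosen by any other rule, possibly dependent on the state of the whole network, as long as the rule always allows at least one decision. -/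

import Mathlib

namespace OFR

noncomputable section

variable {n : ℕ} {k : Fin n → ℕ}

/-! ## The torus -/

/-- Nodes of the `n`-dimensional torus of size `k 0 × ⋯ × k (n-1)` (all `k i` positive). -/
abbrev Node (k : Fin n → ℕ) : Type := (i : Fin n) → ZMod (k i)

/-- A unidirectional link: it leaves the node `src` along dimension `dim`, in the positive
direction if `pos = true` and in the negative direction otherwise. -/
structure Link (k : Fin n → ℕ) where
  src : Node k
  dim : Fin n
  pos : Bool

/-- The node at which a link ends. -/
def Link.tgt (l : Link k) : Node k :=
  Function.update l.src l.dim (if l.pos then l.src l.dim + 1 else l.src l.dim - 1)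

/-- Distance between two positions of a cycle of length `m`. -/
def ringDist {m : ℕ} (a b : ZMod m) : ℕ := min (b - a).val (a - b).val

/-- Distance between two nodes of the torus. -/
def dist (u v : Node k) : ℕ := ∑ i, ringDist (u i) (v i)

/-- The link `l` lies on a minimal path from its source to `t`: traversing it decreases the
distance to `t`.  (If `l.src` and `t` are antipodal along the dimension of `l`, both of the
directions are minimal.) -/
def Link.IsMinimal (l : Link k) (t : Node k) : Prop :=
  ringDist (l.tgt l.dim) (t l.dim) < ringDist (l.src l.dim) (t l.dim)

/-- The link `l` is a legal first link of a minimal dimension-order route from its source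
to `t`: it is minimal, and all the lower dimensions have been corrected already. -/
def Link.IsDimOrder (l : Link k) (t : Node k) : Prop :=
  l.IsMinimal t ∧ ∀ j < l.dim, l.src j = t j

/-! ## Configurations of the network -/

/-- The virtual channels of a link: the adaptive one, and the two escape ones that the escape
(bubble) channel is split into. -/
inductive VC where
  | adaptive
  | vs1
  | vs2

/-- A packet: its name, its final destination, and the intermediate destination that it still
has to visit, if any. -/
structure Packet (k : Fin n → ℕ) where
  name : ℕ
  dst : Node k
  idn : Option (Node k)

/-- The node towards which a packet is currently routed. -/
def Packet.target (p : Packet k) : Node k := p.idn.getD p.dst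

/-- The packet seen by the router of node `v`: an intermediate destination equal to `v` has
been reached, and is removed from the header. -/
def Packet.seenAt (p : Packet k) (v : Node k) : Packet k :=
  if p.idn = some v then { p with idn := none } else p

/-- The escape channel for a packet: the first escape subnetwork for the packets that head to
an intermediate destination, the second one for those that head to their final destination. -/
def Packet.escape (p : Packet k) : VC := if p.idn.isSome then VC.vs1 else VC.vs2

/-- The places where an undelivered packet can be: the generator of a node, or the queue
of a virtual channel of a link. -/
inductive Place (k : Fin n → ℕ) where
  | gen (v : Node k)
  | queue (vc : VC) (l : Link k)

/-- The router that handles the packets waiting at a place. -/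
def Place.router : Place k → Node k
  | .gen v => v
  | .queue _ l => l.tgt

/-- A configuration: the (first-in first-out) content of every place, the packets consumed so
far by the sink of every node, and a fresh name for the next packet. -/
structure Config (k : Fin n → ℕ) where
  content : Place k → List (Packet k)
  sink : Node k → List (Packet k)
  fresh : ℕ

/-- The initial configuration. -/
def Config.initial : Config k where
  content _ := []
  sink _ := []
  fresh := 0

/-- The capacities of the queues of the virtual channels are given by `cap`; the queue of
channel `vc` of link `l` has at least `r` free slots. -/
def Config.HasFree (cap : VC → ℕ) (c : Config k) (vc : VC) (l : Link k) (r : ℕ) : Prop :=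
  (c.content (.queue vc l)).length + r ≤ cap vc

open Classical in
/-- Remove the packet waiting at `x`, whose successors are `rest`, and append `p` to `y`. -/
def Config.transfer (c : Config k) (x : Place k) (rest : List (Packet k)) (y : Place k)
    (p : Packet k) : Config k :=
  { c with
    content := fun z => (if z = x then rest else c.content z) ++ (if z = y then [p] else []) }

open Classical in
/-- Remove the packet waiting at `x`, whose successors are `rest`; node `v` consumes it. -/
def Config.consume (c : Config k) (x : Place k) (rest : List (Packet k)) (v : Node k)
    (p : Packet k) : Config k :=
  { c with
    content := fun z => if z = x then rest else c.content z
    sink := fun w => c.sink w ++ (if w = v then [p] else []) }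

/-! ## The router -/

/-- A derouting rule: `D c s t o` means that in the configuration `c` a packet that is newly
injected at `s` with final destination `t` may be given the optional intermediate
destination `o`. -/
abbrev DeroutingRule (k : Fin n → ℕ) : Type :=
  Config k → Node k → Node k → Option (Node k) → Prop

/-- The rule prescribes at least one decision in every situation. -/
def DeroutingRule.Total (D : DeroutingRule k) : Prop := ∀ c s t, ∃ o, D c s t o

/-- `p` is the first packet at `x` with the header on which the router acts: a packet coming from
a generator is newly injected and is given an optional intermediate destination; an
intermediate destination that has been reached is dropped. -/
inductive Head (D : DeroutingRule k) (c : Config k) : Place k → Packet k → List (Packet k) → Prop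
  | gen {v p rest o} (hc : c.content (.gen v) = p :: rest) (ho : D c v p.dst o) :
      Head D c (.gen v) (({ p with idn := o } : Packet k).seenAt v) rest
  | queue {vc l p rest} (hc : c.content (.queue vc l) = p :: rest) :
      Head D c (.queue vc l) (p.seenAt l.tgt) rest

open Classical in
/-- Number of free slots needed to enter the escape queue of channel `vc` of link `l` from `x`.
One slot is enough for the packets that proceed in the same escape subnetwork along the same
dimension and direction.  All the other insertions (from a generator, from an adaptive queue,
from another dimension, from the other escape subnetwork) are injections: two slots. -/
def slotsNeeded (x : Place k) (vc : VC) (l : Link k) : ℕ :=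
  if ∃ l₀ : Link k, x = .queue vc l₀ ∧ l₀.dim = l.dim ∧ l₀.pos = l.pos then 1 else 2

/-- The moves of packets.
* A packet at its final destination (with no pending intermediate one) is consumed.
* Otherwise it can enter a non-full adaptive queue along any minimal path to its target.
* If all those adaptive queues are full, it can enter its escape subnetwork in
  dimension order, under the bubble condition. -/
inductive Move (cap : VC → ℕ) (D : DeroutingRule k) (c : Config k) : Config k → Prop
  | deliver {x p rest} (hp : Head D c x p rest) (hi : p.idn = none) (hd : p.dst = x.router) :
      Move cap D c (c.consume x rest x.router p)
  | adaptive {x p rest} (hp : Head D c x p rest) (l : Link k) (hs : l.src = x.router)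
      (hl : l.IsMinimal p.target) (hf : c.HasFree cap .adaptive l 1) :
      Move cap D c (c.transfer x rest (.queue .adaptive l) p)
  | escape {x p rest} (hp : Head D c x p rest)
      (hfull : ∀ l : Link k, l.src = x.router → l.IsMinimal p.target →
        ¬ c.HasFree cap .adaptive l 1)
      (l : Link k) (hs : l.src = x.router) (hl : l.IsDimOrder p.target)
      (hf : c.HasFree cap p.escape l (slotsNeeded x p.escape l)) :
      Move cap D c (c.transfer x rest (.queue p.escape l) p)

open Classical in
/-- The generator of `s` produces a packet for `t`. -/
def Config.generate (c : Config k) (s t : Node k) : Config k :=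
  { c with
    content := fun z => c.content z ++ (if z = .gen s then [⟨c.fresh, t, none⟩] else [])
    fresh := c.fresh + 1 }

/-- A step of the network: new traffic (arbitrary), or a move of a packet. -/
inductive Step (cap : VC → ℕ) (D : DeroutingRule k) (c : Config k) : Config k → Prop
  | generate (s t : Node k) : Step cap D c (c.generate s t)
  | move {c₁} (h : Move cap D c c₁) : Step cap D c c₁

/-- The configurations that can occur. -/
def Reachable (cap : VC → ℕ) (D : DeroutingRule k) (c : Config k) : Prop :=
  Relation.ReflTransGen (Step cap D) Config.initial c

/-- The packet named `a` is at the place `x`. -/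
def Config.IsAt (c : Config k) (a : ℕ) (x : Place k) : Prop :=
  ∃ p ∈ c.content x, p.name = a

/-- The packet named `a` is at `x` and will never leave this place, whatever happens. -/
def Config.Stuck (cap : VC → ℕ) (D : DeroutingRule k) (c : Config k) (a : ℕ)
    (x : Place k) : Prop :=
  ∀ c₁, Relation.ReflTransGen (Step cap D) c c₁ → c₁.IsAt a x

/-- Freedom from deadlock. -/
structure DeadlockFree (cap : VC → ℕ) (D : DeroutingRule k) : Prop where
  /-- No packet, in the network or at a generator, is ever permanently stuck. -/
  not_stuck : ∀ c, Reachable cap D c → ∀ a x, ¬ c.Stuck cap D a x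
  /-- As long as there is an undelivered packet, some packet can move. -/
  progress : ∀ c, Reachable cap D c → (∃ x, c.content x ≠ []) → ∃ c₁, Move cap D c c₁
  /-- Without the help of new traffic, all the packets present can be delivered. -/
  delivery : ∀ c, Reachable cap D c → ∃ c₁, Relation.ReflTransGen (Move cap D) c c₁ ∧
    (∀ x, c₁.content x = []) ∧
    ∀ x, ∀ p ∈ c.content x, ∃ p₁ ∈ c₁.sink p.dst, p₁.name = p.name

/-- Use of the virtual channels: no queue overflows, and the escape subnetworks carry only packets
heading to an intermediate, respectively to their final, destination. -/
structure ChannelsRespected (cap : VC → ℕ) (D : DeroutingRule k) : Prop where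
  capacity : ∀ c, Reachable cap D c → ∀ vc l, (c.content (.queue vc l)).length ≤ cap vc
  vs1 : ∀ c, Reachable cap D c → ∀ l, ∀ p ∈ c.content (.queue .vs1 l), p.idn ≠ none
  vs2 : ∀ c, Reachable cap D c → ∀ l, ∀ p ∈ c.content (.queue .vs2 l), p.idn = none

/-! ## The derouting rule of OutFlank Routing -/

/-- Wraparound intermediate destinations: `q i = ⌊(s i + t i + β i * k i) / 2⌋`. -/
def IsWIDN (s t q : Node k) : Prop :=
  ∃ β : Fin n → Fin 2, ∀ i, q i = (((s i).val + (t i).val + (β i).val * k i) / 2 : ℕ)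

open Classical in
/-- Coordinates of the outflank intermediate destinations. -/
def oidnCoord (Δ : ℕ) (s t : Node k) (lam : Fin n → SignType) (i : Fin n) : ZMod (k i) :=
  if s i = t i then
    match lam i with
    | .neg => s i - Δ
    | .zero => s i
    | .pos => s i + Δ
  else
    match lam i with
    | .neg => if (Link.mk s i false).IsMinimal t then t i - Δ else s i - Δ
    | .zero => (((s i).val + (t i).val) / 2 : ℕ)
    | .pos => if (Link.mk s i true).IsMinimal t then t i + Δ else s i + Δ

/-- Outflank intermediate destinations `q`.  They have to exploit a non-minimal link both in `s` and
in `t` (the links into `t` are described by their reversals, which leave `t`). -/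
def IsOIDN (Δ : ℕ) (s t q : Node k) : Prop :=
  (∃ lam : Fin n → SignType, q = oidnCoord Δ s t lam) ∧
  (∃ i b, (Link.mk s i b).IsMinimal q ∧ ¬ (Link.mk s i b).IsMinimal t) ∧
  (∃ i b, (Link.mk t i b).IsMinimal q ∧ ¬ (Link.mk t i b).IsMinimal s)

/-- Number of used slots in (all the virtual channels of) a link. -/
def Config.used (c : Config k) (l : Link k) : ℕ :=
  (c.content (.queue .adaptive l)).length + (c.content (.queue .vs1 l)).length
    + (c.content (.queue .vs2 l)).length

open Classical in
/-- Average number of used slots in the outgoing links of `s` that are minimal from `s` to `q`. -/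
def Config.avgUsed (c : Config k) (s q : Node k) : ℝ :=
  let L := Finset.univ.filter fun d : Fin n × Bool => (Link.mk s d.1 d.2).IsMinimal q
  (∑ d ∈ L, (c.used (Link.mk s d.1 d.2) : ℝ)) / L.card

/-- Minimum number of used slots in an outgoing link of `s`. -/
def Config.minUsed (c : Config k) (s : Node k) : ℝ :=
  ⨅ d : Fin n × Bool, (c.used (Link.mk s d.1 d.2) : ℝ)

open Classical in
/-- Congestion part of the profit, equal to one if both of its terms vanish. -/
def Config.congestion (c : Config k) (s q : Node k) : ℝ :=
  if c.minUsed s = 0 ∧ c.avgUsed s q = 0 then 1 else c.minUsed s / c.avgUsed s q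

/-- Profit of routing from `s` to `t` through `q`. -/
def Config.profit (η : ℝ) (c : Config k) (s t q : Node k) : ℝ :=
  c.congestion s q + η * (dist s t / (dist s q + dist q t : ℝ))

/-- Profit of routing minimally from `s` to `t`. -/
def Config.profitMin (η : ℝ) (c : Config k) (s t : Node k) : ℝ := c.congestion s t + η

/-- The derouting rule of OutFlank Routing, with sets `Q s t` of candidates: no derouting if
no candidate is more profitable than minimal routing, and otherwise a most profitable
candidate is chosen. -/
def outflankRule (η : ℝ) (Q : Node k → Node k → Finset (Node k)) : DeroutingRule k :=
  fun c s t o => match o with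
    | none => ∀ q ∈ Q s t, c.profit η s t q ≤ c.profitMin η s t
    | some q => q ∈ Q s t ∧ (∃ r ∈ Q s t, c.profitMin η s t < c.profit η s t r) ∧
        ∀ r ∈ Q s t, c.profit η s t r ≤ c.profit η s t q

end

end OFR

namespace OFR

variable {n : ℕ} {k : Fin n → ℕ}

/-! ### Distances on a cycle and on the torus -/

/-! The only property of the derouting rule that matters is that it always allows some decision.
OutFlank Routing has this property because a profit attains its maximum on a finite nonempty set.

Safety is the bubble invariant `Inv`: every unidirectional ring of an escape subnetwork keeps a
queue that is not full. An injection uses one of two free slots, and a packet that advances within a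
ring frees a slot behind it (`Inv.transfer`).

Progress (`Inv.progress`) rests on the order: `vs1` before `vs2`, and lower dimensions before higher
ones. In a nonempty subnetwork whose leaving packets are not blocked, look at the highest occupied
dimension. A packet that is done with this dimension can be delivered, or can turn into an empty
queue. So if nothing moves, every nonempty queue is followed by a full one, all the way round the
ring, against the bubble (`Inv.exists_move_of_escape`). This applies to `vs2`, which packets leave
only for the sink; if `vs2` is empty, it applies to `vs1`; if both are empty, every waiting packet
can enter its escape subnetwork, unless it can be delivered or enter an adaptive queue.

Termination: packets are derouted only at injection and every hop is minimal, so the total remaining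
route length is a decreasing potential (`Move.potential_lt`). Progress and termination together
drain the network, which also excludes stuck packets. -/

theorem val_sub_one {m : ℕ} [NeZero m] {x : ZMod m} (hx : x ≠ 0) : (x - 1).val = x.val - 1 := by
  have hv : x.val ≠ 0 := by rwa [Ne, ZMod.val_eq_zero]
  have hlt := x.val_lt
  have h1 : (1 : ZMod m).val = 1 := by
    have : Fact (1 < m) := ⟨by omega⟩
    exact ZMod.val_one m
  rw [ZMod.val_sub (by omega), h1]

theorem ringDist_comm {m : ℕ} (a b : ZMod m) : ringDist a b = ringDist b a := min_comm _ _

theorem ringDist_self {m : ℕ} (a : ZMod m) : ringDist a a = 0 := by simp [ringDist]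

theorem ringDist_neg {m : ℕ} (a b : ZMod m) : ringDist (-a) (-b) = ringDist a b := by
  rw [ringDist_comm, ringDist, ringDist, neg_sub_neg, neg_sub_neg]

theorem ringDist_eq {m : ℕ} [NeZero m] (a b : ZMod m) :
    ringDist a b = min (b - a).val (m - (b - a).val) := by
  rw [ringDist, ← neg_sub b a, ZMod.neg_val]
  split_ifs with h
  · simp [h]
  · rfl

theorem ringDist_le {m : ℕ} [NeZero m] (a b : ZMod m) : ringDist a b ≤ m :=
  (min_le_left _ _).trans (ZMod.val_lt _).le

theorem ringDist_add_one_lt {m : ℕ} [NeZero m] {a b : ZMod m} (hab : a ≠ b)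
    (h : 2 * (b - a).val ≤ m) : ringDist (a + 1) b < ringDist a b := by
  have hx : b - a ≠ 0 := sub_ne_zero.2 hab.symm
  have hv : (b - a).val ≠ 0 := by rwa [Ne, ZMod.val_eq_zero]
  have := (b - a).val_lt
  rw [ringDist_eq, ringDist_eq, ← sub_sub, val_sub_one hx]
  omega

theorem two_mul_val_le {m : ℕ} [NeZero m] {a b : ZMod m}
    (h : ringDist (a + 1) b < ringDist a b) : 2 * (b - a).val ≤ m := by
  by_cases hab : a = b
  · simp [hab]
  have hx : b - a ≠ 0 := sub_ne_zero.2 (Ne.symm hab)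
  have := (b - a).val_lt
  rw [ringDist_eq, ringDist_eq, ← sub_sub, val_sub_one hx] at h
  omega

/-- A step shortens the distance exactly when the arc ahead is nonempty and at most half of the
cycle; the step only shortens this arc. Hence even a tie between antipodal positions, once broken,
stays broken the same way. -/
theorem ringDist_add_one_continue {m : ℕ} [NeZero m] {a b : ZMod m}
    (h : ringDist (a + 1) b < ringDist a b) (hne : a + 1 ≠ b) :
    ringDist (a + 1 + 1) b < ringDist (a + 1) b := by
  have hab : a ≠ b := by
    rintro rfl
    rw [ringDist_self] at h
    omega
  have h2 := two_mul_val_le h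
  refine ringDist_add_one_lt hne ?_
  rw [← sub_sub, val_sub_one (sub_ne_zero.2 hab.symm)]
  omega

theorem ringDist_sub_one_continue {m : ℕ} [NeZero m] {a b : ZMod m}
    (h : ringDist (a - 1) b < ringDist a b) (hne : a - 1 ≠ b) :
    ringDist (a - 1 - 1) b < ringDist (a - 1) b := by
  have e : ∀ x : ZMod m, ringDist (x - 1) b = ringDist (-x + 1) (-b) := fun x => by
    rw [← ringDist_neg, neg_sub, sub_eq_neg_add]
  rw [e, ← ringDist_neg a b] at h
  rw [e (a - 1), e a, neg_sub, sub_eq_neg_add]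
  refine ringDist_add_one_continue h fun h' => hne ?_
  rw [← neg_inj, ← h', neg_sub, sub_eq_neg_add]

theorem exists_ringDist_lt {m : ℕ} [NeZero m] {a b : ZMod m} (hab : a ≠ b) :
    ringDist (a + 1) b < ringDist a b ∨ ringDist (a - 1) b < ringDist a b := by
  by_cases h : 2 * (b - a).val ≤ m
  · exact .inl (ringDist_add_one_lt hab h)
  · right
    -- The reflection `x ↦ -x` exchanges the two arcs and reduces this to the positive direction.
    rw [← ringDist_neg, ← ringDist_neg a b, neg_sub, sub_eq_neg_add]
    refine ringDist_add_one_lt (fun h' => hab (neg_injective h')) ?_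
    rw [neg_sub_neg, ← neg_sub b a, ZMod.neg_val]
    split_ifs <;> omega

/-- A set of positions of a cycle that is closed under steps in one direction is everything. -/
theorem forall_of_step {m : ℕ} [NeZero m] {P : ZMod m → Prop} (pos : Bool)
    (step : ∀ a, P a → P (if pos then a + 1 else a - 1)) {a : ZMod m} (ha : P a) (b : ZMod m) :
    P b := by
  cases pos
  · have h : ∀ j : ℕ, P (a - j) := by
      intro j
      induction j with
      | zero => simpa using ha
      | succ j ih => simpa [sub_sub] using step _ ih
    simpa using h (a - b).val
  · have h : ∀ j : ℕ, P (a + j) := by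
      intro j
      induction j with
      | zero => simpa using ha
      | succ j ih => simpa [add_assoc] using step _ ih
    simpa using h (b - a).val

theorem Link.tgt_of_ne (l : Link k) {j : Fin n} (h : j ≠ l.dim) : l.tgt j = l.src j := by
  simp [Link.tgt, h]

/-- The next link in the same direction. -/
def Link.next (l : Link k) : Link k := ⟨l.tgt, l.dim, l.pos⟩

theorem Link.IsMinimal.next [∀ i, NeZero (k i)] {l : Link k} {t : Node k} (h : l.IsMinimal t)
    (hne : l.tgt l.dim ≠ t l.dim) : l.next.IsMinimal t := by
  obtain ⟨s, i, b⟩ := l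
  unfold Link.IsMinimal at h ⊢
  cases b
  · simp only [Link.next, Link.tgt, Function.update_self, Bool.false_eq_true, if_false] at h hne ⊢
    exact ringDist_sub_one_continue h hne
  · simp only [Link.next, Link.tgt, Function.update_self, if_true] at h hne ⊢
    exact ringDist_add_one_continue h hne

/-- A packet on a dimension-order route that has not finished its dimension may go straight on; this
is the move for which one free slot is enough. -/
theorem Link.IsDimOrder.next [∀ i, NeZero (k i)] {l : Link k} {t : Node k} (h : l.IsDimOrder t)
    (hne : l.tgt l.dim ≠ t l.dim) : l.next.IsDimOrder t :=
  ⟨h.1.next hne, fun j hj => (l.tgt_of_ne (ne_of_lt hj)).trans (h.2 j hj)⟩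

theorem exists_isDimOrder [∀ i, NeZero (k i)] {v t : Node k} (h : v ≠ t) :
    ∃ l : Link k, l.src = v ∧ l.IsDimOrder t := by
  obtain ⟨i₀, h₀⟩ := Function.ne_iff.1 h
  obtain ⟨i, hi, hmin⟩ := WellFounded.has_min (wellFounded_lt (α := Fin n))
    {i | v i ≠ t i} ⟨i₀, h₀⟩
  have hlow : ∀ j < i, v j = t j := fun j hj => by
    by_contra hne
    exact hmin j hne hj
  rcases exists_ringDist_lt hi with hd | hd
  · exact ⟨⟨v, i, true⟩, rfl, by simpa [Link.IsMinimal, Link.tgt] using hd, hlow⟩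
  · exact ⟨⟨v, i, false⟩, rfl, by simpa [Link.IsMinimal, Link.tgt] using hd, hlow⟩

theorem dist_self (v : Node k) : dist v v = 0 := by simp [dist, ringDist_self]

theorem dist_le [∀ i, NeZero (k i)] (u v : Node k) : dist u v ≤ ∑ i, k i :=
  Finset.sum_le_sum fun _ _ => ringDist_le _ _

theorem Link.IsMinimal.dist_lt {l : Link k} {t : Node k} (h : l.IsMinimal t) :
    dist l.tgt t < dist l.src t := by
  refine Finset.sum_lt_sum (fun j _ => ?_) ⟨l.dim, Finset.mem_univ _, h⟩
  by_cases hj : j = l.dim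
  · subst hj
    exact h.le
  · rw [l.tgt_of_ne hj]

/-! ### Heads of the queues and moves -/

theorem Packet.seenAt_idn_ne (p : Packet k) (v : Node k) : (p.seenAt v).idn ≠ some v := by
  unfold Packet.seenAt
  split_ifs with h
  · simp
  · exact h

theorem Packet.seenAt_name (p : Packet k) (v : Node k) : (p.seenAt v).name = p.name := by
  unfold Packet.seenAt
  split_ifs <;> rfl

theorem Packet.seenAt_dst (p : Packet k) (v : Node k) : (p.seenAt v).dst = p.dst := by
  unfold Packet.seenAt
  split_ifs <;> rfl

theorem Packet.seenAt_of_idn_eq_none {p : Packet k} (h : p.idn = none) (v : Node k) :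
    p.seenAt v = p := by
  simp [Packet.seenAt, h]

theorem Packet.escape_eq_vs1 {p : Packet k} : p.escape = .vs1 ↔ p.idn ≠ none := by
  unfold Packet.escape
  cases p.idn <;> simp

theorem Packet.escape_eq_vs2 {p : Packet k} : p.escape = .vs2 ↔ p.idn = none := by
  unfold Packet.escape
  cases p.idn <;> simp

/-- Dropping an intermediate destination switches the packet from `vs1` to `vs2`. A packet that
stays in its subnetwork thus keeps its target, and what the invariant says about its route still
applies. -/
theorem Packet.seenAt_of_escape_eq {p : Packet k} {v : Node k}
    (h : (p.seenAt v).escape = p.escape) : p.seenAt v = p := by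
  unfold Packet.seenAt at h ⊢
  split_ifs at h ⊢ with h'
  · simp [Packet.escape, h'] at h
  · rfl

/-- For a header already processed at `v`, having arrived at the target means being ready for
consumption. -/
theorem Packet.idn_eq_none_of_target {p : Packet k} {v : Node k} (h : p.target = v)
    (hv : p.idn ≠ some v) : p.idn = none ∧ p.dst = v := by
  unfold Packet.target at h
  cases hi : p.idn with
  | none => simpa [hi] using h
  | some q => simp_all

variable {cap : VC → ℕ} {D : DeroutingRule k} {c c' : Config k}

theorem Head.idn_ne {x : Place k} {p rest} (h : Head D c x p rest) : p.idn ≠ some x.router := by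
  cases h <;> exact Packet.seenAt_idn_ne _ _

theorem Head.exists_cons {x : Place k} {p rest} (h : Head D c x p rest) :
    ∃ p₀, c.content x = p₀ :: rest ∧ p₀.name = p.name ∧ p₀.dst = p.dst := by
  cases h with
  | gen hc ho => exact ⟨_, hc, by rw [Packet.seenAt_name], by rw [Packet.seenAt_dst]⟩
  | queue hc => exact ⟨_, hc, by rw [Packet.seenAt_name], by rw [Packet.seenAt_dst]⟩

theorem exists_head (hD : D.Total) {x : Place k} (h : c.content x ≠ []) :
    ∃ p rest, Head D c x p rest := by
  obtain ⟨p, rest, hc⟩ := List.exists_cons_of_ne_nil h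
  cases x with
  | gen v =>
    obtain ⟨o, ho⟩ := hD c v p.dst
    exact ⟨_, _, .gen hc ho⟩
  | queue vc l => exact ⟨_, _, .queue hc⟩

theorem slotsNeeded_le (x : Place k) (vc : VC) (l : Link k) : slotsNeeded x vc l ≤ 2 := by
  unfold slotsNeeded
  split_ifs <;> omega

theorem one_le_slotsNeeded (x : Place k) (vc : VC) (l : Link k) : 1 ≤ slotsNeeded x vc l := by
  unfold slotsNeeded
  split_ifs <;> omega

theorem Config.HasFree.mono {vc : VC} {l : Link k} {r r' : ℕ} (h : c.HasFree cap vc l r)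
    (hr : r' ≤ r) : c.HasFree cap vc l r' := by
  unfold Config.HasFree at *
  omega

/-- A packet that can proceed in the escape subnetworks can move. -/
theorem exists_move_of_isDimOrder {x : Place k} {p rest} (hp : Head D c x p rest) {l : Link k}
    (hs : l.src = x.router) (hl : l.IsDimOrder p.target)
    (hf : c.HasFree cap p.escape l (slotsNeeded x p.escape l)) : ∃ c₁, Move cap D c c₁ := by
  by_cases hfull : ∀ l : Link k, l.src = x.router → l.IsMinimal p.target →
      ¬ c.HasFree cap .adaptive l 1
  · exact ⟨_, .escape hp hfull l hs hl hf⟩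
  · push Not at hfull
    obtain ⟨l, hs, hl, hf⟩ := hfull
    exact ⟨_, .adaptive hp l hs hl hf⟩

/-- A packet whose escape subnetwork accepts injections can move. -/
theorem exists_move_of_hasFree [∀ i, NeZero (k i)] {x : Place k} {p rest}
    (hp : Head D c x p rest) (hf : ∀ l, c.HasFree cap p.escape l 2) : ∃ c₁, Move cap D c c₁ := by
  by_cases ht : p.target = x.router
  · obtain ⟨hi, hd⟩ := Packet.idn_eq_none_of_target ht hp.idn_ne
    exact ⟨_, .deliver hp hi hd⟩
  · obtain ⟨l, hs, hl⟩ := exists_isDimOrder (Ne.symm ht)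
    exact exists_move_of_isDimOrder hp hs hl ((hf l).mono (slotsNeeded_le _ _ _))

/-- Every move consumes a packet at its destination, or makes it enter a queue. -/
theorem Move.consume_or_transfer (h : Move cap D c c') :
    ∃ x p rest, Head D c x p rest ∧
      ((p.idn = none ∧ p.dst = x.router ∧ c' = c.consume x rest x.router p) ∨
      ∃ vc l, l.src = x.router ∧ l.IsMinimal p.target ∧ c.HasFree cap vc l 1 ∧
        (vc ≠ .adaptive → vc = p.escape ∧ l.IsDimOrder p.target ∧
          c.HasFree cap vc l (slotsNeeded x vc l)) ∧
        c' = c.transfer x rest (.queue vc l) p) := by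
  cases h with
  | deliver hp hi hd => exact ⟨_, _, _, hp, .inl ⟨hi, hd, rfl⟩⟩
  | adaptive hp l hs hl hf =>
    exact ⟨_, _, _, hp, .inr ⟨_, l, hs, hl, hf, fun h => absurd rfl h, rfl⟩⟩
  | escape hp _ l hs hl hf =>
    exact ⟨_, _, _, hp, .inr ⟨_, l, hs, hl.1, hf.mono (one_le_slotsNeeded _ _ _),
      fun _ => ⟨rfl, hl, hf⟩, rfl⟩⟩

/-! ### The invariant -/

/-- The invariant of the router: no queue overflows, every unidirectional ring of an escape
subnetwork has a non-full queue (the bubble), and the escape subnetworks hold only packets of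
their kind, on dimension-order routes. -/
structure Inv (cap : VC → ℕ) (c : Config k) : Prop where
  capacity : ∀ vc l, (c.content (.queue vc l)).length ≤ cap vc
  bubble : ∀ vc, vc ≠ .adaptive → ∀ u i b, ∃ a,
    (c.content (.queue vc ⟨Function.update u i a, i, b⟩)).length < cap vc
  escape : ∀ vc, vc ≠ .adaptive → ∀ l, ∀ p ∈ c.content (.queue vc l), p.escape = vc
  dimOrder : ∀ vc, vc ≠ .adaptive → ∀ l, ∀ p ∈ c.content (.queue vc l), l.IsDimOrder p.target

theorem Inv.initial (hcap : ∀ vc, vc ≠ .adaptive → 2 ≤ cap vc) :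
    Inv cap (Config.initial : Config k) where
  capacity _ _ := Nat.zero_le _
  bubble vc h _ _ _ := ⟨0, lt_of_lt_of_le (by simp [Config.initial]) (hcap vc h)⟩
  escape _ _ _ p hp := by simp [Config.initial] at hp
  dimOrder _ _ _ p hp := by simp [Config.initial] at hp

/-- The invariant passes to configurations with shorter queues. -/
theorem Inv.of_sublist (hc : Inv cap c)
    (h : ∀ vc l, (c'.content (.queue vc l)).Sublist (c.content (.queue vc l))) : Inv cap c' where
  capacity vc l := (h vc l).length_le.trans (hc.capacity vc l)
  bubble vc hv u i b :=
    (hc.bubble vc hv u i b).imp fun _ ha => (h _ _).length_le.trans_lt ha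
  escape vc hv l p hp := hc.escape vc hv l p ((h vc l).subset hp)
  dimOrder vc hv l p hp := hc.dimOrder vc hv l p ((h vc l).subset hp)

/-- The bubble of a ring is at risk only if the packet enters the very queue that witnesses it.
After an injection this queue still has a free slot; after a step along the ring, the queue just
left takes over as witness. -/
theorem Inv.transfer (hc : Inv cap c) {x : Place k} {p₀ p : Packet k} {rest : List (Packet k)}
    (hx : c.content x = p₀ :: rest) {vc : VC} {l : Link k}
    (hs : l.src = x.router) (hf : c.HasFree cap vc l 1)
    (hesc : vc ≠ .adaptive → vc = p.escape ∧ l.IsDimOrder p.target ∧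
      c.HasFree cap vc l (slotsNeeded x vc l)) :
    Inv cap (c.transfer x rest (.queue vc l) p) := by
  classical
  have hsub : ∀ z, (if z = x then rest else c.content z).Sublist (c.content z) := by
    intro z
    split_ifs with h
    · rw [h, hx]
      exact List.sublist_cons_self _ _
    · exact List.Sublist.refl _
  have hmem : ∀ z, ∀ r ∈ (c.transfer x rest (.queue vc l) p).content z,
      r ∈ c.content z ∨ z = .queue vc l ∧ r = p := by
    intro z r hr
    rcases List.mem_append.1 hr with hr | hr
    · exact .inl ((hsub z).subset hr)
    · split_ifs at hr with h
      · exact .inr ⟨h, by simpa using hr⟩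
      · simp at hr
  have hlen : ∀ z, z ≠ .queue vc l →
      ((c.transfer x rest (.queue vc l) p).content z).length ≤ (c.content z).length := by
    intro z hz
    simpa [Config.transfer, hz] using (hsub z).length_le
  have hlen' : ((c.transfer x rest (.queue vc l) p).content (.queue vc l)).length ≤
      (c.content (.queue vc l)).length + 1 := by
    simpa [Config.transfer] using (hsub (.queue vc l)).length_le
  refine ⟨fun vc' l' => ?_, fun vc' hv u i b => ?_, fun vc' hv l' r hr => ?_,
    fun vc' hv l' r hr => ?_⟩
  · by_cases h : Place.queue vc' l' = .queue vc l
    · rw [h]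
      obtain rfl : vc' = vc := by injection h
      exact hlen'.trans hf
    · exact (hlen _ h).trans (hc.capacity vc' l')
  · obtain ⟨a, ha⟩ := hc.bubble vc' hv u i b
    by_cases h : Place.queue vc' ⟨Function.update u i a, i, b⟩ = .queue vc l
    · obtain ⟨rfl, rfl⟩ : vc' = vc ∧ (⟨Function.update u i a, i, b⟩ : Link k) = l := by
        injection h with h₁ h₂
        exact ⟨h₁, h₂⟩
      obtain ⟨-, -, hfree⟩ := hesc hv
      unfold Config.HasFree slotsNeeded at hfree
      split_ifs at hfree with h₀
      · obtain ⟨⟨u₀, i₀, b₀⟩, rfl, hdim, hpos⟩ := h₀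
        simp only at hdim hpos hs
        subst hdim hpos
        -- The queue left by the packet belongs to the same ring: its link ends at the source of the
        -- entered one, so only the coordinate `i₀` differs.
        have hu : u₀ = Function.update u i₀ (u₀ i₀) := by
          funext j
          by_cases hj : j = i₀
          · subst hj
            simp
          · have := congrFun hs j
            simp only [Place.router, Link.tgt, Function.update_of_ne hj] at this ⊢
            exact this.symm
        refine ⟨u₀ i₀, ?_⟩
        rw [← hu]
        -- The two queues coincide when the ring has length one. The length of the queue is then
        -- unchanged, and it had a free slot.
        by_cases he : Place.queue vc' (⟨u₀, i₀, b₀⟩ : Link k) =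
            .queue vc' ⟨Function.update u i₀ a, i₀, b₀⟩
        · rw [← he]
          rw [← he, hx] at hfree
          simp only [Config.transfer, if_true, List.length_append, List.length_cons,
            List.length_nil] at hfree ⊢
          omega
        · have hcap := hc.capacity vc' ⟨u₀, i₀, b₀⟩
          rw [hx] at hcap
          simpa [Config.transfer, he] using hcap
      · exact ⟨a, by omega⟩
    · exact ⟨a, (hlen _ h).trans_lt ha⟩
  · rcases hmem _ r hr with hr | ⟨he, rfl⟩
    · exact hc.escape vc' hv l' r hr
    · obtain ⟨rfl, rfl⟩ : vc' = vc ∧ l' = l := by simpa using he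
      exact (hesc hv).1.symm
  · rcases hmem _ r hr with hr | ⟨he, rfl⟩
    · exact hc.dimOrder vc' hv l' r hr
    · obtain ⟨rfl, rfl⟩ : vc' = vc ∧ l' = l := by simpa using he
      exact (hesc hv).2.1

theorem Inv.move (hc : Inv cap c) (h : Move cap D c c') : Inv cap c' := by
  obtain ⟨x, p, rest, hp, ⟨-, -, rfl⟩ | ⟨vc, l, hs, -, hf, hesc, rfl⟩⟩ := h.consume_or_transfer
  · obtain ⟨p₀, hx, -⟩ := hp.exists_cons
    refine hc.of_sublist fun vc l => ?_
    simp only [Config.consume]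
    split_ifs with h
    · rw [h, hx]
      exact List.sublist_cons_self _ _
    · exact List.Sublist.refl _
  · obtain ⟨p₀, hx, -⟩ := hp.exists_cons
    exact hc.transfer hx hs hf hesc

theorem Inv.of_reachable (hcap : ∀ vc, vc ≠ .adaptive → 2 ≤ cap vc) (h : Reachable cap D c) :
    Inv cap c := by
  induction h with
  | refl => exact Inv.initial hcap
  | tail _ hstep ih =>
    cases hstep with
    | generate s t => exact ih.of_sublist fun vc l => by simp [Config.generate]
    | move h => exact ih.move h

/-! ### Progress -/

theorem hasFree_two_of_eq_nil {vc : VC} (hcap : 2 ≤ cap vc) {l : Link k}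
    (h : c.content (.queue vc l) = []) : c.HasFree cap vc l 2 := by
  simpa [Config.HasFree, h] using hcap

/-- A nonempty escape subnetwork contains a packet that can move, if the packets that have to
leave it can do so. -/
theorem Inv.exists_move_of_escape [∀ i, NeZero (k i)] (hc : Inv cap c) {vc : VC}
    (hv : vc ≠ .adaptive) (hcap : 2 ≤ cap vc) (hne : ∃ l, c.content (.queue vc l) ≠ [])
    (hout : ∀ l, ∀ p ∈ c.content (.queue vc l), (p.seenAt l.tgt).escape ≠ vc →
      ∀ l', c.HasFree cap (p.seenAt l.tgt).escape l' 2) :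
    ∃ c₁, Move cap D c c₁ := by
  by_contra hno
  obtain ⟨l₀, h₀⟩ := hne
  -- The highest occupied dimension: all the queues of this subnetwork in higher dimensions are
  -- empty.
  obtain ⟨i, ⟨⟨u, i', b⟩, rfl, hl⟩, hmax⟩ := Set.exists_max_image
    {i | ∃ l : Link k, l.dim = i ∧ c.content (.queue vc l) ≠ []} id (Set.toFinite _) ⟨_, l₀, rfl, h₀⟩
  simp only [Set.mem_ofPred_eq, id] at hmax
  have hfull : ∀ l : Link k, l.dim = i' → c.content (.queue vc l) ≠ [] →
      cap vc ≤ (c.content (.queue vc l.next)).length := by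
    intro l hdim hl
    obtain ⟨p, rest, hx⟩ := List.exists_cons_of_ne_nil hl
    have hmem : p ∈ c.content (.queue vc l) := by simp [hx]
    have hp : Head D c (.queue vc l) (p.seenAt l.tgt) rest := .queue hx
    by_cases hesc : (p.seenAt l.tgt).escape = vc
    · have hpe := hc.escape vc hv l p hmem
      have hdo := hc.dimOrder vc hv l p hmem
      rw [Packet.seenAt_of_escape_eq (hesc.trans hpe.symm)] at hp
      by_cases hi : l.tgt l.dim = p.target l.dim
      · by_cases ht : p.target = l.tgt
        · obtain ⟨hn, hd⟩ := Packet.idn_eq_none_of_target ht hp.idn_ne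
          exact absurd ⟨_, .deliver hp hn hd⟩ hno
        · obtain ⟨l', hs, hl'⟩ := exists_isDimOrder (Ne.symm ht)
          refine absurd (exists_move_of_isDimOrder hp hs hl' ?_) hno
          rw [hpe]
          refine (hasFree_two_of_eq_nil hcap ?_).mono (slotsNeeded_le _ _ _)
          -- If the next queue were nonempty, its dimension would be at most that of `l`. But all
          -- these coordinates are already correct, so no link along them is minimal.
          by_contra hl''
          have hle : l'.dim ≤ l.dim := hdim ▸ hmax _ ⟨l', rfl, hl''⟩
          have hlt := hl'.1
          have heq : l'.src l'.dim = p.target l'.dim := by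
            rw [hs]
            rcases hle.lt_or_eq with h | h
            · exact (l.tgt_of_ne h.ne).trans (hdo.2 _ h)
            · rw [h, hi]
          unfold Link.IsMinimal at hlt
          rw [heq, ringDist_self] at hlt
          omega
      · by_contra hlen
        refine hno (exists_move_of_isDimOrder hp (l := l.next) rfl (hdo.next hi) ?_)
        rw [hpe, slotsNeeded, if_pos ⟨l, rfl, rfl, rfl⟩]
        exact not_le.1 hlen
    · exact absurd (exists_move_of_hasFree hp (hout l p hmem hesc)) hno
  have hnext : ∀ a, (⟨Function.update u i' a, i', b⟩ : Link k).next =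
      ⟨Function.update u i' (if b then a + 1 else a - 1), i', b⟩ := fun a => by
    simp [Link.next, Link.tgt]
  -- A full queue is nonempty, because the capacity is positive; so nonemptiness travels round the
  -- ring.
  have hne : ∀ a, c.content (.queue vc ⟨Function.update u i' a, i', b⟩) ≠ [] :=
    forall_of_step (a := u i') b (fun a ha => by
      have := hfull _ rfl ha
      rw [hnext] at this
      exact List.ne_nil_of_length_pos (by omega)) (by simpa using hl)
  obtain ⟨a, ha⟩ := hc.bubble vc hv u i' b
  -- The predecessor of the bubble queue is nonempty, which forces the bubble queue to be full.
  have := hfull ⟨Function.update u i' (if b then a - 1 else a + 1), i', b⟩ rfl (hne _)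
  rw [hnext] at this
  have e : (if b then (if b then a - 1 else a + 1) + 1 else (if b then a - 1 else a + 1) - 1) = a := by
    cases b <;> simp
  rw [e] at this
  omega

theorem Inv.progress [∀ i, NeZero (k i)] (hc : Inv cap c) (hD : D.Total)
    (hcap : ∀ vc, vc ≠ .adaptive → 2 ≤ cap vc) (hne : ∃ x, c.content x ≠ []) :
    ∃ c₁, Move cap D c c₁ := by
  by_cases h2 : ∃ l, c.content (.queue .vs2 l) ≠ []
  · refine hc.exists_move_of_escape (by simp) (hcap _ (by simp)) h2 fun l p hp hesc => ?_
    have hi := Packet.escape_eq_vs2.1 (hc.escape .vs2 (by simp) l p hp)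
    -- Packets in `vs2` have no intermediate destination left to drop, so none of them changes
    -- subnetwork.
    rw [Packet.seenAt_of_idn_eq_none hi] at hesc
    exact absurd (Packet.escape_eq_vs2.2 hi) hesc
  push Not at h2
  have free2 : ∀ l, c.HasFree cap .vs2 l 2 := fun l =>
    hasFree_two_of_eq_nil (hcap _ (by simp)) (h2 l)
  by_cases h1 : ∃ l, c.content (.queue .vs1 l) ≠ []
  · refine hc.exists_move_of_escape (by simp) (hcap _ (by simp)) h1 fun l p hp hesc => ?_
    -- A packet leaving `vs1` is one that has reached its intermediate destination; it is headed for
    -- `vs2`, which is empty.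
    rw [Ne, Packet.escape_eq_vs1, not_not] at hesc
    rw [Packet.escape_eq_vs2.2 hesc]
    exact free2
  push Not at h1
  have free1 : ∀ l, c.HasFree cap .vs1 l 2 := fun l =>
    hasFree_two_of_eq_nil (hcap _ (by simp)) (h1 l)
  obtain ⟨x, hx⟩ := hne
  obtain ⟨p, rest, hp⟩ := exists_head hD hx
  refine exists_move_of_hasFree hp ?_
  unfold Packet.escape
  split_ifs
  · exact free1
  · exact free2

/-! ### Termination -/

instance : Finite VC :=
  Finite.of_injective (β := Fin 3) (fun | .adaptive => 0 | .vs1 => 1 | .vs2 => 2) (by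
    rintro (_ | _ | _) (_ | _ | _) h <;> first | rfl | (simp at h))

instance [∀ i, NeZero (k i)] : Finite (Link k) :=
  Finite.of_injective (β := Node k × Fin n × Bool) (fun l => (l.src, l.dim, l.pos)) (by
    rintro ⟨_, _, _⟩ ⟨_, _, _⟩ h
    simpa using h)

instance [∀ i, NeZero (k i)] : Finite (Place k) :=
  Finite.of_injective (β := Node k ⊕ VC × Link k)
    (fun | .gen v => .inl v | .queue vc l => .inr (vc, l)) (by
    rintro (_ | _) (_ | _) h <;> simp_all)

/-- Length of a minimal route of a packet from a node to its final destination, through its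
intermediate destination. -/
def Packet.routeLength (p : Packet k) (v : Node k) : ℕ := dist v p.target + dist p.target p.dst

/-- Number of moves that suffice for the delivery of a packet at a given place. -/
def Packet.potential (p : Packet k) : Place k → ℕ
  | .gen _ => 2 * (∑ i, k i) + 2
  | .queue _ l => p.routeLength l.tgt + 1

theorem Packet.routeLength_le [∀ i, NeZero (k i)] (p : Packet k) (v : Node k) :
    p.routeLength v ≤ 2 * ∑ i, k i := by
  have h₁ := dist_le v p.target
  have h₂ := dist_le p.target p.dst
  unfold Packet.routeLength
  omega

/-- An intermediate destination is dropped at distance zero from it, so the first leg contributes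
nothing. -/
theorem Packet.routeLength_seenAt (p : Packet k) (v : Node k) :
    (p.seenAt v).routeLength v = p.routeLength v := by
  unfold Packet.seenAt
  split_ifs with h
  · simp [Packet.routeLength, Packet.target, h, dist_self]
  · rfl

/-- Bound for the number of moves without new traffic. -/
noncomputable def Config.potential [∀ i, NeZero (k i)] (c : Config k) : ℕ :=
  letI := Fintype.ofFinite (Place k)
  ∑ x, ((c.content x).map fun p => p.potential x).sum

open Classical in
/-- The total potential of all the packets but the first one at `x`, whose successors
are `rest`. -/
noncomputable def Config.potentialErase [∀ i, NeZero (k i)] (c : Config k) (x : Place k)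
    (rest : List (Packet k)) : ℕ :=
  letI := Fintype.ofFinite (Place k)
  ∑ z, ((if z = x then rest else c.content z).map fun p => p.potential z).sum

theorem Config.potential_eq [∀ i, NeZero (k i)] {x : Place k} {p : Packet k}
    {rest : List (Packet k)} (h : c.content x = p :: rest) :
    c.potential = c.potentialErase x rest + p.potential x := by
  classical
  let _ := Fintype.ofFinite (Place k)
  have : p.potential x = ∑ z, if z = x then p.potential x else 0 := by simp
  rw [this]
  unfold Config.potential Config.potentialErase
  rw [← Finset.sum_add_distrib]
  refine Finset.sum_congr rfl fun z _ => ?_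
  split_ifs with hz
  · subst hz
    rw [h, List.map_cons, List.sum_cons, add_comm]
  · rfl

theorem Config.potential_transfer [∀ i, NeZero (k i)] (x y : Place k) (p : Packet k)
    (rest : List (Packet k)) :
    (c.transfer x rest y p).potential = c.potentialErase x rest + p.potential y := by
  classical
  let _ := Fintype.ofFinite (Place k)
  have : p.potential y = ∑ z, if z = y then p.potential y else 0 := by simp
  rw [this]
  unfold Config.potential Config.potentialErase
  rw [← Finset.sum_add_distrib]
  refine Finset.sum_congr rfl fun z _ => ?_
  simp only [Config.transfer, List.map_append, List.sum_append]
  congr 1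
  split_ifs with hz <;> simp [hz]

theorem Head.exists_potential [∀ i, NeZero (k i)] {x : Place k} {p rest}
    (h : Head D c x p rest) :
    ∃ p₀, c.content x = p₀ :: rest ∧ p.routeLength x.router + 1 ≤ p₀.potential x := by
  cases h with
  | gen hc ho =>
    -- The potential at a generator exceeds every two-leg route length, so it covers any choice of
    -- intermediate destination.
    exact ⟨_, hc, Nat.succ_le_succ ((Packet.routeLength_le _ _).trans (Nat.le_succ _))⟩
  | queue hc =>
    refine ⟨_, hc, ?_⟩
    simp only [Place.router, Packet.potential, Packet.routeLength_seenAt]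
    exact le_rfl

/-- A hop along a minimal link shortens the leg to the current target and leaves the other leg
alone; a consumption removes a positive term. -/
theorem Move.potential_lt [∀ i, NeZero (k i)] (h : Move cap D c c') :
    c'.potential < c.potential := by
  obtain ⟨x, p, rest, hp, ⟨-, -, rfl⟩ | ⟨vc, l, hs, hmin, -, -, rfl⟩⟩ := h.consume_or_transfer
  · obtain ⟨p₀, hx, hle⟩ := hp.exists_potential
    rw [Config.potential_eq hx]
    change c.potentialErase x rest < _
    omega
  · obtain ⟨p₀, hx, hle⟩ := hp.exists_potential
    rw [Config.potential_eq hx, Config.potential_transfer]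
    have := hmin.dist_lt
    rw [hs] at this
    simp only [Packet.potential, Packet.routeLength] at hle ⊢
    omega

/-! ### Delivery -/

theorem Move.sink_subset (h : Move cap D c c') (v : Node k) : c.sink v ⊆ c'.sink v := by
  obtain ⟨x, p, rest, hp, ⟨-, -, rfl⟩ | ⟨vc, l, -, -, -, -, rfl⟩⟩ := h.consume_or_transfer
  · exact List.subset_append_left _ _
  · exact List.Subset.refl _

/-- No packet is lost. -/
theorem Move.exists_packet (h : Move cap D c c') {z : Place k} {r : Packet k}
    (hr : r ∈ c.content z) :
    (∃ z', ∃ r' ∈ c'.content z', r'.name = r.name ∧ r'.dst = r.dst) ∨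
      ∃ r' ∈ c'.sink r.dst, r'.name = r.name := by
  classical
  obtain ⟨x, p, rest, hp, hcase⟩ := h.consume_or_transfer
  obtain ⟨p₀, hx, hname, hdst⟩ := hp.exists_cons
  have hr' : r = p₀ ∨ r ∈ if z = x then rest else c.content z := by
    split_ifs with hz
    · rw [hz, hx] at hr
      exact List.mem_cons.1 hr
    · exact .inr hr
  rcases hcase with ⟨-, hd, rfl⟩ | ⟨vc, l, -, -, -, -, rfl⟩
  · rcases hr' with rfl | hr'
    · refine .inr ⟨p, ?_, hname.symm⟩
      simp [Config.consume, hdst, hd]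
    · exact .inl ⟨z, r, hr', rfl, rfl⟩
  · left
    rcases hr' with rfl | hr'
    · exact ⟨.queue vc l, p, by simp [Config.transfer], hname.symm, hdst.symm⟩
    · exact ⟨z, r, List.mem_append_left _ hr', rfl, rfl⟩

/-- Recursion on the potential, with one available move at a time. The clause that sinks only grow
is carried along so that a packet consumed by the first move still counts at the end. -/
theorem Inv.delivery {c : Config k} [∀ i, NeZero (k i)] (hD : D.Total)
    (hcap : ∀ vc, vc ≠ .adaptive → 2 ≤ cap vc) (hc : Inv cap c) :
    ∃ c₁, Relation.ReflTransGen (Move cap D) c c₁ ∧ (∀ x, c₁.content x = []) ∧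
      (∀ v, c.sink v ⊆ c₁.sink v) ∧
      ∀ x, ∀ p ∈ c.content x, ∃ p₁ ∈ c₁.sink p.dst, p₁.name = p.name := by
  by_cases hne : ∃ x, c.content x ≠ []
  · obtain ⟨c', h⟩ := hc.progress hD hcap hne
    have := h.potential_lt
    obtain ⟨c₁, hstar, hnil, hsink, hdel⟩ := Inv.delivery hD hcap (hc.move h)
    refine ⟨c₁, .head h hstar, hnil, fun v _ hr => hsink v (h.sink_subset v hr), fun x p hp => ?_⟩
    rcases h.exists_packet hp with ⟨x', p', hp', hname, hdst⟩ | ⟨p', hp', hname⟩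
    · rw [← hname, ← hdst]
      exact hdel x' p' hp'
    · exact ⟨p', hsink _ hp', hname⟩
  · push Not at hne
    exact ⟨c, .refl, hne, fun _ => List.Subset.refl _, fun x p hp => by simp [hne] at hp⟩
termination_by c.potential

theorem deadlockFree_of_total [∀ i, NeZero (k i)] (hD : D.Total)
    (hcap : ∀ vc, vc ≠ .adaptive → 2 ≤ cap vc) : DeadlockFree cap D where
  not_stuck c hc a x hstuck := by
    obtain ⟨c₁, hstar, hnil, -⟩ := (Inv.of_reachable hcap hc).delivery hD hcap
    -- Once the network is drained, nothing is left at `x`.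
    obtain ⟨p, hp, -⟩ := hstuck c₁ (hstar.lift id fun _ _ h => Step.move h)
    simp [hnil] at hp
  progress c hc hne := (Inv.of_reachable hcap hc).progress hD hcap hne
  delivery c hc := by
    obtain ⟨c₁, hstar, hnil, -, hdel⟩ := (Inv.of_reachable hcap hc).delivery hD hcap
    exact ⟨c₁, hstar, hnil, hdel⟩

theorem channelsRespected (hcap : ∀ vc, vc ≠ .adaptive → 2 ≤ cap vc) :
    ChannelsRespected cap D where
  capacity _ hc := (Inv.of_reachable hcap hc).capacity
  vs1 _ hc l p hp :=
    Packet.escape_eq_vs1.1 ((Inv.of_reachable hcap hc).escape .vs1 (by simp) l p hp)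
  vs2 _ hc l p hp :=
    Packet.escape_eq_vs2.1 ((Inv.of_reachable hcap hc).escape .vs2 (by simp) l p hp)

theorem outflankRule_total (η : ℝ) (Q : Node k → Node k → Finset (Node k)) :
    (outflankRule η Q).Total := by
  intro c s t
  by_cases h : ∀ q ∈ Q s t, c.profit η s t q ≤ c.profitMin η s t
  · exact ⟨none, h⟩
  · push Not at h
    -- Some candidate beats minimal routing, so the candidate set is nonempty and a maximal profit
    -- exists.
    obtain ⟨q, hq, hmax⟩ := (Q s t).exists_max_image (c.profit η s t) (h.imp fun _ hr => hr.1)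
    exact ⟨some q, hq, h, hmax⟩

end OFR

/-- OutFlank Routing over the bubble router with two escape subnetworks is free from deadlock,
for all candidate sets of wraparound and outflank intermediate destinations; more generally, so is
every router that differs from it only in the way the intermediate destinations are chosen. -/
theorem theorem1 {n : ℕ} (k : Fin n → ℕ) (hk : ∀ i, 0 < k i)
    (cap : OFR.VC → ℕ) (h1 : 2 ≤ cap .vs1) (h2 : 2 ≤ cap .vs2) :
    (∀ (Δ : ℕ) (η : ℝ) (Q : OFR.Node k → OFR.Node k → Finset (OFR.Node k)),
      (∀ s t, ∀ q ∈ Q s t, OFR.IsWIDN s t q ∨ OFR.IsOIDN Δ s t q) →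
        OFR.DeadlockFree cap (OFR.outflankRule η Q) ∧
        OFR.ChannelsRespected cap (OFR.outflankRule η Q)) ∧
    (∀ D : OFR.DeroutingRule k, D.Total →
        OFR.DeadlockFree cap D ∧ OFR.ChannelsRespected cap D) := by
  have : ∀ i, NeZero (k i) := fun i => ⟨(hk i).ne'⟩
  have hcap : ∀ vc, vc ≠ .adaptive → 2 ≤ cap vc := by
    rintro (_ | _ | _) h
    · exact absurd rfl h
    · exact h1
    · exact h2
  exact ⟨fun _ η Q _ => ⟨OFR.deadlockFree_of_total (OFR.outflankRule_total η Q) hcap,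
    OFR.channelsRespected hcap⟩,
    fun _ hD => ⟨OFR.deadlockFree_of_total hD hcap, OFR.channelsRespected hcap⟩⟩
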